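/- Let $n\ge 1$ and $0<s<1$. Let $C_\infty(\mathbb{R}^n)$ be the Banach space of (real- or complex-valued) continuous functions on $\mathbb{R}^n$ vanishing at infinity, with the sup-norm. For $u\in C_c^\infty(\mathbb{R}^n)$ put $$(-\Delta)^s u(x) = -c_s\int_{y\neq 0}\bigl(u(x+y)-u(x)-y\cdot\nabla u(x)\,\mathbf 1_{(0,1)}(|y|)\bigr)\,|y|^{-n-2s}\,dy,\qquad c_s=\frac{s\,4^s\,\Gamma\left(s+\frac n2\right)}{\pi^{n/2}\,\Gamma(1-s)},$$ and let $\bigl((-\Delta)^s,\mathcal D((-\Delta)^s)\bigr)$ be the closure in $C_\infty(\mathbb{R}^n)$ of the operator $\bigl((-\Delta)^s,C_c^\infty(\mathbb{R}^n)\bigr)$, i.e. the operator whose graph is the closure of $\{(u,(-\Delta)^su) : u\in C_c^\infty(\mathbb{R}^n)\}$ in $C_\infty(\mathbb{R}^n)\times C_\infty(\mathbb{R}^n)$. Then $(-\Delta)^s$ satisfies the unique continuation principle: for every non-empty open set $G\subset\mathbb{R}^n$ and every $u\in\mathcal D((-\Delta)^s)$, $$(-\Delta)^s u|_G=0 \ \text{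 and }\ u|_G=0 \quad\Longrightarrow\quad u=0 \text{ on } \mathbb{R}^n .$$ -/

import Mathlib

open MeasureTheory
open scoped ContDiff ZeroAtInfty

noncomputable section

/-- The normalizing constant `c_s = s 4^s π^{-n/2} Γ(s + n/2) / Γ(1 - s)`. -/
def fracLaplacianConst (n : ℕ) (s : ℝ) : ℝ :=
  s * (4 : ℝ) ^ s * Real.pi ^ (-(n : ℝ) / 2) * Real.Gamma (s + (n : ℝ) / 2) / Real.Gamma (1 - s)

/-- The Lévy operator with characteristic triplet `(0, 0, c_s |y|^{-n-2s} dy)`,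
`A u(x) = ∫_{y ≠ 0} (u(x+y) - u(x) - y·∇u(x) 1_{(0,1)}(|y|)) c_s |y|^{-n-2s} dy`.
The point `y = 0`, where the integrand below is `0`, does not contribute. For smooth compactly
supported `u` and `0 < s < 1` the integral converges absolutely and, as the kernel is even, equals
the limit for `ε → 0` of the integrals of `(u(x+y) - u(x)) c_s |y|^{-n-2s}` over `|y| > ε`. -/
def fracLevy {𝕜 : Type*} [RCLike 𝕜] {n : ℕ} (s : ℝ)
    (u : EuclideanSpace ℝ (Fin n) → 𝕜) (x : EuclideanSpace ℝ (Fin n)) : 𝕜 :=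
  ∫ y : EuclideanSpace ℝ (Fin n),
    (fracLaplacianConst n s * ‖y‖ ^ (-(n : ℝ) - 2 * s)) •
      (u (x + y) - u x - if ‖y‖ < 1 then fderiv ℝ u x y else 0)

/-- The fractional Laplacian `(-Δ)^s u = -A u` on test functions, `A` being the Lévy operator with
triplet `(0, 0, c_s |y|^{-n-2s} dy)`; with this sign its Fourier symbol is `|ξ|^{2s}`. -/
def fracLaplacian {𝕜 : Type*} [RCLike 𝕜] {n : ℕ} (s : ℝ)
    (u : EuclideanSpace ℝ (Fin n) → 𝕜) (x : EuclideanSpace ℝ (Fin n)) : 𝕜 :=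
  -fracLevy s u x

/-- The graph of `(-Δ)^s` with domain `C_c^∞(ℝⁿ)`, as an operator in `C_∞(ℝⁿ)`, the Banach space
(with the sup-norm) of the continuous functions vanishing at infinity. -/
def fracLaplacianTestGraph (𝕜 : Type*) [RCLike 𝕜] (n : ℕ) (s : ℝ) :
    Set (C₀(EuclideanSpace ℝ (Fin n), 𝕜) × C₀(EuclideanSpace ℝ (Fin n), 𝕜)) :=
  {p | ContDiff ℝ ∞ p.1 ∧ HasCompactSupport p.1 ∧ ∀ x, p.2 x = fracLaplacian s p.1 x}

section
variable {𝕜 : Type*} [RCLike 𝕜] {n : ℕ} {s : ℝ}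

/-- The dominating function of the integrand is integrable. -/
lemma fracKernel_integrable (hn : 1 ≤ n) (hs0 : 0 < s) (hs1 : s < 1) (c K M : ℝ) :
    Integrable (fun y : EuclideanSpace ℝ (Fin n) =>
      |c * ‖y‖ ^ (-(n : ℝ) - 2 * s)| * (if ‖y‖ < 1 then K * ‖y‖ ^ 2 else M)) volume := by
  have : Nonempty (Fin n) := ⟨⟨0, hn⟩⟩
  refine (integrable_fun_norm_addHaar (E := EuclideanSpace ℝ (Fin n)) volume (f := fun r : ℝ =>
    |c * r ^ (-(n : ℝ) - 2 * s)| * (if r < 1 then K * r ^ 2 else M))).2 ?_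
  rw [finrank_euclideanSpace_fin, ← Set.Ioo_union_Ici_eq_Ioi zero_lt_one]
  have key : ∀ r : ℝ, 0 < r → r ^ (n - 1) * r ^ (-(n : ℝ) - 2 * s) = r ^ (-1 - 2 * s) := by
    intro r hr
    rw [← Real.rpow_natCast, ← Real.rpow_add hr]
    congr 1
    push_cast [hn]
    ring
  refine IntegrableOn.union ?_ ?_
  · have h := (intervalIntegral.integrableOn_Ioo_rpow_iff (s := 1 - 2 * s) zero_lt_one).2
      (by linarith)
    refine IntegrableOn.congr_fun (h.const_mul (|c| * K)) ?_ measurableSet_Ioo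
    intro r hr
    have h0 : 0 ≤ r ^ (-(n : ℝ) - 2 * s) := Real.rpow_nonneg hr.1.le _
    have e : r ^ (1 - 2 * s) = r ^ (-1 - 2 * s) * r ^ 2 := by
      rw [← Real.rpow_natCast, ← Real.rpow_add hr.1]; congr 1; push_cast; ring
    simp only [abs_mul, abs_of_nonneg h0, if_pos hr.2, smul_eq_mul]
    rw [e, ← key r hr.1]; ring
  · rw [integrableOn_Ici_iff_integrableOn_Ioi]
    have h := integrableOn_Ioi_rpow_of_lt (a := -1 - 2 * s) (by linarith) zero_lt_one
    refine IntegrableOn.congr_fun (h.const_mul (|c| * M)) ?_ measurableSet_Ioi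
    intro r hr
    have hr0 : 0 < r := zero_lt_one.trans hr
    have h0 : 0 ≤ r ^ (-(n : ℝ) - 2 * s) := Real.rpow_nonneg hr0.le _
    simp only [abs_mul, abs_of_nonneg h0, if_neg (not_lt.2 (le_of_lt (Set.mem_Ioi.1 hr))), smul_eq_mul]
    rw [← key r hr0]; ring

/-- `(-Δ)^s` is defined on all test functions. -/
theorem exists_mem_fracLaplacianTestGraph (hn : 1 ≤ n) (hs0 : 0 < s) (hs1 : s < 1)
    (u : C₀(EuclideanSpace ℝ (Fin n), 𝕜)) (hu : ContDiff ℝ ∞ u) (hc : HasCompactSupport u) :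
    ∃ f, (u, f) ∈ fracLaplacianTestGraph 𝕜 n s := by
  have hd : Differentiable ℝ u := hu.differentiable (by simp)
  have hu' : ContDiff ℝ 1 (fderiv ℝ u) := hu.fderiv_right (by norm_cast)
  have hc' : HasCompactSupport (fderiv ℝ u) := hc.fderiv (𝕜 := ℝ)
  obtain ⟨K, hK⟩ := hu'.lipschitzWith_of_hasCompactSupport hc' (by simp)
  obtain ⟨M, hM⟩ := hu.continuous.bounded_above_of_compact_support hc
  let F : EuclideanSpace ℝ (Fin n) → EuclideanSpace ℝ (Fin n) → 𝕜 := fun x y =>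
    (fracLaplacianConst n s * ‖y‖ ^ (-(n : ℝ) - 2 * s)) •
      (u (x + y) - u x - if ‖y‖ < 1 then fderiv ℝ u x y else 0)
  have hb : ∀ x y, ‖F x y‖ ≤ |fracLaplacianConst n s * ‖y‖ ^ (-(n : ℝ) - 2 * s)| *
      (if ‖y‖ < 1 then K * ‖y‖ ^ 2 else 2 * M) := by
    intro x y
    simp only [F, norm_smul, Real.norm_eq_abs]
    refine mul_le_mul_of_nonneg_left ?_ (abs_nonneg _)
    split_ifs with h
    · have := (convex_closedBall x ‖y‖).norm_image_sub_le_of_norm_fderiv_le' (𝕜 := ℝ) (f := u)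
        (φ := fderiv ℝ u x) (C := K * ‖y‖) (x := x) (y := x + y) (fun z _ => hd z)
        (fun z hz => ?_) (by simp) (by simp)
      · simpa [pow_two, mul_assoc] using this
      · refine (hK.norm_sub_le z x).trans ?_
        gcongr
        simpa [dist_eq_norm] using hz
    · rw [sub_zero]
      refine (norm_sub_le _ _).trans ?_
      linarith [hM (x + y), hM x]
  have hm : ∀ x, AEStronglyMeasurable (F x) volume := by
    intro x
    refine Measurable.aestronglyMeasurable ?_
    refine Measurable.smul (by fun_prop) (Measurable.sub ?_ ?_)
    · exact ((hu.continuous.comp (by fun_prop)).sub continuous_const).measurable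
    · exact Measurable.ite (measurableSet_lt measurable_norm measurable_const)
        (fderiv ℝ u x).continuous.measurable measurable_const
  have hi := fracKernel_integrable hn hs0 hs1 (fracLaplacianConst n s) K (2 * M)
  have hcont : Continuous (fun x => ∫ y, F x y) := by
    refine continuous_of_dominated hm (fun x => .of_forall (hb x)) hi (.of_forall fun y => ?_)
    have h1 := hu.continuous
    have h2 := hu'.continuous
    simp only [F]
    split_ifs <;> fun_prop
  have hlim : Filter.Tendsto (fun x => ∫ y, F x y)
      (Filter.cocompact (EuclideanSpace ℝ (Fin n))) (nhds 0) := by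
    have : (Filter.cocompact (EuclideanSpace ℝ (Fin n))).IsCountablyGenerated := by
      rw [← Metric.cobounded_eq_cocompact, ← comap_norm_atTop]; infer_instance
    rw [show (0 : 𝕜) = ∫ y : EuclideanSpace ℝ (Fin n), (0 : 𝕜) by simp]
    refine tendsto_integral_filter_of_dominated_convergence _ (.of_forall hm)
      (.of_forall fun x => .of_forall (hb x)) hi (.of_forall fun y => ?_)
    have t0 : Filter.Tendsto u (Filter.cocompact _) (nhds 0) := u.zero_at_infty'
    have t1 : Filter.Tendsto (fun x => u (x + y)) (Filter.cocompact _) (nhds 0) :=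
      t0.comp (Homeomorph.addRight y).isClosedEmbedding.tendsto_cocompact
    have t2 : Filter.Tendsto (fun x => fderiv ℝ u x y) (Filter.cocompact _) (nhds 0) := by
      have : Filter.Tendsto (fderiv ℝ u) (Filter.cocompact _) (nhds 0) := hc'.is_zero_at_infty
      simpa [Function.comp_def] using ((ContinuousLinearMap.apply ℝ 𝕜 y).continuous.tendsto 0).comp this
    simp only [F]
    split_ifs
    · simpa using ((t1.sub t0).sub t2).const_smul (fracLaplacianConst n s * ‖y‖ ^ (-(n : ℝ) - 2 * s))
    · simpa using (t1.sub t0).const_smul (fracLaplacianConst n s * ‖y‖ ^ (-(n : ℝ) - 2 * s))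
  exact ⟨-⟨⟨_, hcont⟩, hlim⟩, hu, hc, fun x => rfl⟩
end

/-- The graph of the closure `((-Δ)^s, D((-Δ)^s))` in `C_∞(ℝⁿ)` of `((-Δ)^s, C_c^∞(ℝⁿ))`:
`(u, f)` belongs to it iff `u ∈ D((-Δ)^s)` and `(-Δ)^s u = f`; the closure of the graph is again the
graph of an operator, since `((-Δ)^s, C_c^∞(ℝⁿ))` is closable. -/
def fracLaplacianGraph (𝕜 : Type*) [RCLike 𝕜] (n : ℕ) (s : ℝ) :
    Set (C₀(EuclideanSpace ℝ (Fin n), 𝕜) × C₀(EuclideanSpace ℝ (Fin n), 𝕜)) :=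
  closure (fracLaplacianTestGraph 𝕜 n s)

/-- The unique continuation principle for an operator `A` in `C_∞(ℝⁿ)` given by its graph: if `u`
is in the domain of `A` and both `u` and `f = A u` vanish on a non-empty open set `G`, then
`u = 0` on all of `ℝⁿ`. -/
def SatisfiesUCP {𝕜 : Type*} [RCLike 𝕜] {n : ℕ}
    (A : Set (C₀(EuclideanSpace ℝ (Fin n), 𝕜) × C₀(EuclideanSpace ℝ (Fin n), 𝕜))) : Prop :=
  ∀ G : Set (EuclideanSpace ℝ (Fin n)), IsOpen G → G.Nonempty →
    ∀ u f : C₀(EuclideanSpace ℝ (Fin n), 𝕜), (u, f) ∈ A →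
      (∀ x ∈ G, f x = 0) → (∀ x ∈ G, u x = 0) → ∀ x, u x = 0

end

/-! Put `b = n + 2s` and let `u` and `f = (-Δ)^s u` vanish on a ball of radius `r` about `x₀`. On
test functions the operator is symmetric, and this identity survives the closure of the graph, so
`u` pairs to zero with `fracLevy s φ` for every test `φ` supported in the ball of radius `r / 2`.
Where `u` can be nonzero, `fracLevy s φ` is just a constant times the potential of `φ` with kernel
`‖x - z‖ ^ (-b)`. Varying `φ` shows that `∫ u x * ‖x - y‖ ^ (-b) dx = 0` for all `y` near `x₀`
(`integral_smul_eq_of_mem_fracLaplacianGraph`,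
`eq_zero_of_weak_integral_mul_rpow_norm_sub_eq_zero`).

The Laplacian in `y` sends `‖x - y‖ ^ (-b)` to `b (b + 2 - n) ‖x - y‖ ^ (-b - 2)`, with nonzero
factor, so by iteration all exponents `b + 2k` give zero. On the support of `u` the variable `t = ‖x
- y‖ ^ (-2)` stays in a compact interval, and Weierstrass approximation of `t ^ (-b/2) * exp (-1/t)`
turns these moments into the Gaussian average of `u` around `y`
(`integral_mul_gaussian_eq_zero_of_moments`).

Gaussian averages extend to an entire function of the centre along each complex line. Vanishing near
a point, they vanish for imaginary shifts too, so the Fourier transform of `u` times a Gaussian is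
zero, and `u = 0` (`eq_zero_of_integral_mul_gaussian_eq_zero`). -/

/-! ### Gaussian averages determine a bounded continuous function. -/

section Gaussian

variable {E : Type*} [NormedAddCommGroup E] [InnerProductSpace ℝ E] [FiniteDimensional ℝ E]
  [MeasurableSpace E] [BorelSpace E]

lemma integrable_exp_neg_norm_sq_add_mul_norm (a : ℝ) :
    Integrable (fun x : E => Real.exp (-‖x‖ ^ 2 + a * ‖x‖)) := by
  -- The bound `a t ≤ a² / 2 + t² / 2` costs the factor `exp (a² / 2)` and leaves half of the
  -- Gaussian.
  have h := (GaussianFourier.integrable_cexp_neg_mul_sq_norm_add (V := E) (b := (1 / 2 : ℂ))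
    (by norm_num) 0 0).norm.const_mul (Real.exp (a ^ 2 / 2))
  refine h.mono' (by fun_prop) (.of_forall fun x => ?_)
  rw [Real.norm_eq_abs, Real.abs_exp, Complex.norm_exp, ← Real.exp_add, Real.exp_le_exp]
  have : (-(1 / 2 : ℂ) * (‖x‖ : ℂ) ^ 2 + 0 * ((inner ℝ (0 : E) x : ℝ) : ℂ)).re
      = -(1 / 2) * ‖x‖ ^ 2 := by
    rw [zero_mul, add_zero]
    norm_cast
    norm_num
    rw [← Complex.ofReal_pow, Complex.ofReal_re]
  rw [this]
  nlinarith [sq_nonneg (a - ‖x‖)]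

/-- The complex parameter joins two regimes: real `z` gives translated Gaussians up to a factor,
imaginary `z` gives Fourier characters. -/
lemma differentiable_integral_mul_cexp {w : E → ℝ} (hw : Continuous w) {M : ℝ}
    (hM : ∀ x, |w x| ≤ M) (v : E) :
    Differentiable ℂ (fun z : ℂ => ∫ x : E,
      (w x : ℂ) * Complex.exp (-(‖x‖ : ℂ) ^ 2 + z * (inner ℝ x v : ℝ))) := by
  intro z
  have hM0 : 0 ≤ M := (abs_nonneg _).trans (hM 0)
  have hin : ∀ x : E, |(inner ℝ x v : ℝ)| ≤ ‖v‖ * ‖x‖ := fun x => by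
    rw [mul_comm]; exact abs_real_inner_le_norm x v
  have hnorm : ∀ (z' : ℂ) (x : E), ‖Complex.exp (-(‖x‖ : ℂ) ^ 2 + z' * (inner ℝ x v : ℝ))‖ ≤
      Real.exp (-‖x‖ ^ 2 + ‖z'‖ * ‖v‖ * ‖x‖) := by
    intro z' x
    rw [Complex.norm_exp, Real.exp_le_exp, Complex.add_re, Complex.re_mul_ofReal]
    have e : (-(‖x‖ : ℂ) ^ 2).re = -‖x‖ ^ 2 := by norm_cast
    rw [e]
    have := (le_abs_self (z'.re * (inner ℝ x v : ℝ)))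
    rw [abs_mul] at this
    have h2 := mul_le_mul (Complex.abs_re_le_norm z') (hin x) (abs_nonneg _) (norm_nonneg _)
    linarith
  have hcont : ∀ z' : ℂ, Continuous (fun x : E =>
      (w x : ℂ) * Complex.exp (-(‖x‖ : ℂ) ^ 2 + z' * (inner ℝ x v : ℝ))) := by
    intro z'
    have : Continuous fun x : E => (inner ℝ x v : ℝ) := by fun_prop
    fun_prop
  refine (hasDerivAt_integral_of_dominated_loc_of_deriv_le (𝕜 := ℂ)
    (F' := fun z' x => (w x : ℂ) * (Complex.exp (-(‖x‖ : ℂ) ^ 2 + z' * (inner ℝ x v : ℝ)) *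
      (inner ℝ x v : ℝ)))
    -- `‖z‖ + 1` bounds the parameter on the unit ball around `z`; the extra `‖v‖` absorbs the
    -- factor `inner ℝ x v` from the derivative, by `t ≤ exp t`.
    (bound := fun x => M * Real.exp (-‖x‖ ^ 2 + ((‖z‖ + 1) * ‖v‖ + ‖v‖) * ‖x‖))
    (Metric.ball_mem_nhds z one_pos) (.of_forall fun z' => (hcont z').aestronglyMeasurable) ?_ ?_ ?_
    ((integrable_exp_neg_norm_sq_add_mul_norm _).const_mul M) ?_).2.differentiableAt
  · refine ((integrable_exp_neg_norm_sq_add_mul_norm (‖z‖ * ‖v‖)).const_mul M).mono'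
      (hcont z).aestronglyMeasurable (.of_forall fun x => ?_)
    rw [norm_mul, Complex.norm_real]
    exact mul_le_mul (hM x) (hnorm z x) (norm_nonneg _) hM0
  · have : Continuous fun x : E => (inner ℝ x v : ℝ) := by fun_prop
    refine Continuous.aestronglyMeasurable ?_
    fun_prop
  · refine .of_forall fun x z' hz' => ?_
    rw [norm_mul, norm_mul, Complex.norm_real, Complex.norm_real]
    refine mul_le_mul (hM x) ?_ (by positivity) hM0
    rw [add_mul, ← add_assoc, Real.exp_add]
    have hz : ‖z'‖ ≤ ‖z‖ + 1 := by
      have := norm_le_norm_add_norm_sub' z' z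
      rw [Metric.mem_ball, dist_eq_norm] at hz'
      rw [norm_sub_rev] at this
      rw [norm_sub_rev] at hz'
      linarith
    refine mul_le_mul ((hnorm z' x).trans ?_) ?_ (norm_nonneg _) (Real.exp_pos _).le
    · rw [Real.exp_le_exp]; gcongr
    · have := Real.add_one_le_exp (‖v‖ * ‖x‖)
      exact (hin x).trans (by linarith)
  · refine .of_forall fun x z' _ => ?_
    have h1 : HasDerivAt (fun z' : ℂ => -(‖x‖ : ℂ) ^ 2 + z' * (inner ℝ x v : ℝ))
        ((inner ℝ x v : ℝ) : ℂ) z' := by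
      simpa using ((hasDerivAt_id z').mul_const ((inner ℝ x v : ℝ) : ℂ)).const_add (-(‖x‖ : ℂ) ^ 2)
    exact h1.cexp.const_mul _

/-- A bounded continuous function whose Gaussian averages vanish near the origin is zero. -/
theorem eq_zero_of_integral_mul_gaussian_eq_zero {w : E → ℝ} (hw : Continuous w) {M : ℝ}
    (hM : ∀ x, |w x| ≤ M) {r : ℝ} (hr : 0 < r)
    (h : ∀ y : E, ‖y‖ < r → ∫ x, w x * Real.exp (-‖x - y‖ ^ 2) = 0) (x : E) : w x = 0 := by
  have hzero : ∀ (v : E) (z : ℂ), ∫ x : E,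
      (w x : ℂ) * Complex.exp (-(‖x‖ : ℂ) ^ 2 + z * (inner ℝ x v : ℝ)) = 0 := by
    intro v
    have hd := differentiable_integral_mul_cexp hw hM v
    have hreal : ∀ t : ℝ, |t| * ‖v‖ < 2 * r → ∫ x : E,
        (w x : ℂ) * Complex.exp (-(‖x‖ : ℂ) ^ 2 + (t : ℂ) * (inner ℝ x v : ℝ)) = 0 := by
      intro t ht
      -- Expanding `‖x - (t / 2) • v‖ ^ 2` produces exactly the linear term `t * inner ℝ x v`,
      -- whence the factor `1 / 2`.
      have h0 := h ((t / 2) • v) (by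
        rw [norm_smul, Real.norm_eq_abs, abs_div, abs_two]; linarith)
      have e : ∀ x : E, (w x : ℂ) * Complex.exp (-(‖x‖ : ℂ) ^ 2 + (t : ℂ) * (inner ℝ x v : ℝ)) =
          ((Real.exp (t ^ 2 / 4 * ‖v‖ ^ 2) * (w x * Real.exp (-‖x - (t / 2) • v‖ ^ 2)) : ℝ) : ℂ) := by
        intro x
        rw [mul_left_comm, ← Real.exp_add, @norm_sub_sq_real, norm_smul, inner_smul_right]
        push_cast
        congr 2
        rw [Real.norm_eq_abs]
        have : ((|t / 2| : ℝ) : ℂ) ^ 2 = (t : ℂ) ^ 2 / 4 := by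
          norm_cast; rw [sq_abs]; ring
        rw [mul_pow, this]
        ring
      simp_rw [e]
      rw [integral_complex_ofReal, integral_const_mul, h0, mul_zero, Complex.ofReal_zero]
    have hA := (hd.differentiableOn (s := Set.univ)).analyticOnNhd isOpen_univ
    -- The known zeros fill a real interval around `0`, which accumulates at `0` in `ℂ`; the
    -- identity theorem does the rest.
    have hfreq : ∃ᶠ z in nhdsWithin (0 : ℂ) {0}ᶜ, (∫ x : E,
      (w x : ℂ) * Complex.exp (-(‖x‖ : ℂ) ^ 2 + z * (inner ℝ x v : ℝ))) = 0 := by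
      have hmap : Filter.Tendsto (fun t : ℝ => (t : ℂ)) (nhdsWithin 0 {0}ᶜ)
          (nhdsWithin (0 : ℂ) {0}ᶜ) := by
        refine tendsto_nhdsWithin_iff.2 ⟨?_, ?_⟩
        · exact (Complex.continuous_ofReal.tendsto' 0 0 (by simp)).mono_left nhdsWithin_le_nhds
        · filter_upwards [self_mem_nhdsWithin] with t ht
          simpa using ht
      refine hmap.frequently (Filter.Eventually.frequently ?_)
      refine nhdsWithin_le_nhds ?_
      have : ∀ᶠ t : ℝ in nhds 0, |t| * ‖v‖ < 2 * r := by
        have hc : Continuous fun t : ℝ => |t| * ‖v‖ := by fun_prop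
        exact hc.tendsto 0 (gt_mem_nhds (by simpa using hr))
      filter_upwards [this] with t ht using hreal t ht
    intro z
    exact hA.eqOn_zero_of_preconnected_of_frequently_eq_zero isPreconnected_univ
      (Set.mem_univ _) hfreq (Set.mem_univ z)
  set f : E → ℂ := fun x => (w x : ℂ) * Complex.exp (-(‖x‖ : ℂ) ^ 2) with hf
  have hfc : Continuous f := by fun_prop
  have hfi : Integrable f := by
    refine ((integrable_exp_neg_norm_sq_add_mul_norm (E := E) 0).const_mul M).mono'
      hfc.aestronglyMeasurable (.of_forall fun x => ?_)
    rw [hf, norm_mul, Complex.norm_real, Complex.norm_exp, zero_mul, add_zero]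
    have e : (-(‖x‖ : ℂ) ^ 2).re = -‖x‖ ^ 2 := by norm_cast
    rw [e]
    exact mul_le_mul_of_nonneg_right (hM x) (Real.exp_pos _).le
  have hF : FourierTransform.fourier f = 0 := by
    funext v
    rw [Real.fourier_eq']
    rw [Pi.zero_apply, ← hzero v (-2 * Real.pi * Complex.I)]
    refine integral_congr_ae (.of_forall fun x => ?_)
    simp only [hf, smul_eq_mul]
    rw [mul_left_comm, ← Complex.exp_add]
    congr 2
    push_cast
    ring
  have hinv := hfc.fourierInv_fourier_eq hfi (by rw [hF]; exact integrable_zero _ _ _)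
  have hx : f x = 0 := by
    rw [← hinv, hF, Real.fourierInv_eq']
    simp
  simpa [hf, Complex.exp_ne_zero] using hx

end Gaussian

/-! ### Uniqueness for potentials with kernel `‖x - y‖ ^ (-b)`, `b > dim E`. -/

section RieszKernel

variable {E : Type*} [NormedAddCommGroup E]

/-- Here `‖x - y‖ ≥ ‖x‖ / 2`, and `‖x‖ / (1 + ‖x‖) ≥ r / (1 + r)` by monotonicity. This gives
majorants independent of `y` for all the kernels below. -/
lemma mul_one_add_norm_le_norm_sub {r : ℝ} (hr : 0 < r) {x y : E} (hx : r ≤ ‖x‖)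
    (hy : ‖y‖ ≤ r / 2) : r / (2 * (1 + r)) * (1 + ‖x‖) ≤ ‖x - y‖ := by
  have h1 : ‖x‖ - ‖y‖ ≤ ‖x - y‖ := norm_sub_norm_le x y
  rw [div_mul_eq_mul_div, div_le_iff₀ (by positivity)]
  nlinarith

lemma rpow_neg_norm_sub_le {r : ℝ} (hr : 0 < r) {x y : E} (hx : r ≤ ‖x‖)
    (hy : ‖y‖ ≤ r / 2) {b : ℝ} (hb : 0 ≤ b) :
    ‖x - y‖ ^ (-b) ≤ (r / (2 * (1 + r))) ^ (-b) * (1 + ‖x‖) ^ (-b) := by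
  rw [← Real.mul_rpow (by positivity) (by positivity)]
  exact Real.rpow_le_rpow_of_nonpos (by positivity) (mul_one_add_norm_le_norm_sub hr hx hy)
    (by linarith)

variable [InnerProductSpace ℝ E] [FiniteDimensional ℝ E] [MeasurableSpace E] [BorelSpace E]

/-- A bounded continuous function vanishing on `‖x‖ < r` is integrable against every kernel
decaying like `‖x - y‖ ^ (-b)` with `b > dim E`, as long as `‖y‖ ≤ r / 2`. -/
lemma integrable_mul_kernel {w : E → ℝ} (hw : Continuous w) {M : ℝ} (hM : ∀ x, |w x| ≤ M)
    {r : ℝ} (hr : 0 < r) (hw0 : ∀ x, ‖x‖ < r → w x = 0) {k : E → ℝ} (hk : Measurable k)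
    {b C : ℝ} (hb : (Module.finrank ℝ E : ℝ) < b) (hkb : ∀ p, p ≠ 0 → |k p| ≤ C * ‖p‖ ^ (-b))
    {y : E} (hy : ‖y‖ ≤ r / 2) : Integrable (fun x => w x * k (x - y)) := by
  have hM0 : 0 ≤ M := (abs_nonneg _).trans (hM 0)
  refine ((integrable_one_add_norm (μ := volume) hb).const_mul
    (M * (|C| * (r / (2 * (1 + r))) ^ (-b)))).mono'
    (hw.measurable.mul (hk.comp (measurable_id.sub_const y))).aestronglyMeasurable
    (.of_forall fun x => ?_)
  have hb0 : 0 ≤ b := (Nat.cast_nonneg _).trans hb.le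
  rcases lt_or_ge ‖x‖ r with hx | hx
  · rw [hw0 x hx, zero_mul, norm_zero]; positivity
  · have hne : x - y ≠ 0 := by
      rw [← norm_pos_iff]
      exact lt_of_lt_of_le (by positivity) (mul_one_add_norm_le_norm_sub hr hx hy)
    rw [norm_mul, Real.norm_eq_abs, Real.norm_eq_abs, mul_assoc, mul_assoc]
    refine mul_le_mul (hM x) ((hkb _ hne).trans ?_) (abs_nonneg _) hM0
    exact mul_le_mul (le_abs_self C) (rpow_neg_norm_sub_le hr hx hy hb0)
      (Real.rpow_nonneg (norm_nonneg _) _) (abs_nonneg _)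

/-- Differentiation of `∫ w x * k (x - y) dx = 0` in direction `e` of the variable `y`. -/
lemma integral_mul_deriv_kernel_eq_zero {w : E → ℝ} (hw : Continuous w) {M : ℝ}
    (hM : ∀ x, |w x| ≤ M) {r : ℝ} (hr : 0 < r) (hw0 : ∀ x, ‖x‖ < r → w x = 0)
    {k k' : E → ℝ} (hk : Measurable k) (hk' : Measurable k') (e : E)
    (hd : ∀ p, p ≠ 0 → HasDerivAt (fun t : ℝ => k (p - t • e)) (k' p) 0)
    {b b' C C' : ℝ} (hb : (Module.finrank ℝ E : ℝ) < b) (hb' : (Module.finrank ℝ E : ℝ) < b')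
    (hkb : ∀ p, p ≠ 0 → |k p| ≤ C * ‖p‖ ^ (-b)) (hkb' : ∀ p, p ≠ 0 → |k' p| ≤ C' * ‖p‖ ^ (-b'))
    (h : ∀ y : E, ‖y‖ < r / 2 → ∫ x, w x * k (x - y) = 0) :
    ∀ y : E, ‖y‖ < r / 2 → ∫ x, w x * k' (x - y) = 0 := by
  intro y hy
  have hM0 : 0 ≤ M := (abs_nonneg _).trans (hM 0)
  have hb0 : 0 ≤ b' := (Nat.cast_nonneg _).trans hb'.le
  have hcont : Continuous fun t : ℝ => ‖y + t • e‖ := by fun_prop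
  have hS : {t : ℝ | ‖y + t • e‖ < r / 2} ∈ nhds (0 : ℝ) :=
    (isOpen_lt hcont continuous_const).mem_nhds (by simpa using hy)
  have hder := (hasDerivAt_integral_of_dominated_loc_of_deriv_le (𝕜 := ℝ) (μ := volume)
    (F := fun t x => w x * k (x - (y + t • e))) (F' := fun t x => w x * k' (x - (y + t • e)))
    (bound := fun x => M * (|C'| * (r / (2 * (1 + r))) ^ (-b')) * (1 + ‖x‖) ^ (-b')) (x₀ := 0)
    hS (.of_forall fun t =>
      (hw.measurable.mul (hk.comp (measurable_id.sub_const _))).aestronglyMeasurable) ?_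
    (hw.measurable.mul (hk'.comp (measurable_id.sub_const _))).aestronglyMeasurable ?_
    ((integrable_one_add_norm (μ := volume) hb').const_mul _) ?_).2
  · have hz : (fun t : ℝ => ∫ x, w x * k (x - (y + t • e))) =ᶠ[nhds 0] fun _ => 0 := by
      filter_upwards [hS] with t ht using h _ ht
    have := (hder.congr_of_eventuallyEq hz.symm).unique (hasDerivAt_const (0 : ℝ) (0 : ℝ))
    simpa using this
  · exact integrable_mul_kernel hw hM hr hw0 hk hb hkb (by simpa using hy.le)
  · refine .of_forall fun x t ht => ?_
    rcases lt_or_ge ‖x‖ r with hx | hx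
    · rw [hw0 x hx, zero_mul, norm_zero]; positivity
    · have hne : x - (y + t • e) ≠ 0 := by
        rw [← norm_pos_iff]
        exact lt_of_lt_of_le (by positivity) (mul_one_add_norm_le_norm_sub hr hx (le_of_lt ht))
      rw [norm_mul, Real.norm_eq_abs, Real.norm_eq_abs, mul_assoc, mul_assoc]
      refine mul_le_mul (hM x) ((hkb' _ hne).trans ?_) (abs_nonneg _) hM0
      exact mul_le_mul (le_abs_self C') (rpow_neg_norm_sub_le hr hx (le_of_lt ht) hb0)
        (Real.rpow_nonneg (norm_nonneg _) _) (abs_nonneg _)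
  · refine .of_forall fun x t ht => ?_
    rcases lt_or_ge ‖x‖ r with hx | hx
    · simpa [hw0 x hx] using hasDerivAt_const t (0 : ℝ)
    · have hne : x - (y + t • e) ≠ 0 := by
        rw [← norm_pos_iff]
        exact lt_of_lt_of_le (by positivity) (mul_one_add_norm_le_norm_sub hr hx (le_of_lt ht))
      refine HasDerivAt.const_mul _ ?_
      -- `hd` differentiates at parameter `0` only; basing it at the point `x - (y + t • e)` gives
      -- the derivative at `t`.
      have h1 : HasDerivAt (fun t' : ℝ => k (x - (y + t • e) - t' • e)) (k' (x - (y + t • e))) 0 :=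
        hd _ hne
      have h2 : HasDerivAt (fun τ : ℝ => k (x - (y + t • e) - (τ - t) • e))
          (k' (x - (y + t • e))) t := by
        rw [← sub_self t] at h1
        exact HasDerivAt.comp_sub_const (f := fun t' : ℝ => k (x - (y + t • e) - t' • e)) t t h1
      refine h2.congr_of_eventuallyEq (.of_forall fun τ => ?_)
      simp only
      congr 1
      module

omit [FiniteDimensional ℝ E] [MeasurableSpace E] [BorelSpace E] in
-- The differentiation is in `y` of a function of `x - y`, hence `p - t • e` and the positive sign
-- of the derivative.
lemma hasDerivAt_norm_sub_smul_rpow {p : E} (hp : p ≠ 0) (e : E) (b : ℝ) :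
    HasDerivAt (fun t : ℝ => ‖p - t • e‖ ^ (-b)) (b * (inner ℝ p e * ‖p‖ ^ (-(b + 2)))) 0 := by
  have h1 : HasDerivAt (fun t : ℝ => p - t • e) (-e) 0 := by
    simpa using ((hasDerivAt_id (0 : ℝ)).smul_const e).const_sub p
  have h2 := h1.norm_sq
  have hpos : 0 < ‖p‖ := norm_pos_iff.2 hp
  have h3 := h2.rpow_const (p := -b / 2) (Or.inl (by simpa using hp))
  have e1 : (fun t : ℝ => ‖p - t • e‖ ^ (-b)) = fun t : ℝ => (‖p - t • e‖ ^ 2) ^ (-b / 2) := by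
    funext t
    rw [← Real.rpow_natCast, ← Real.rpow_mul (norm_nonneg _)]
    congr 1; push_cast; ring
  rw [e1]
  convert h3 using 1
  rw [zero_smul, sub_zero, ← Real.rpow_natCast ‖p‖ 2, ← Real.rpow_mul (norm_nonneg _), inner_neg_right]
  have : ((2 : ℕ) : ℝ) * (-b / 2 - 1) = -(b + 2) := by push_cast; ring
  rw [this]
  ring

omit [FiniteDimensional ℝ E] [MeasurableSpace E] [BorelSpace E] in
lemma hasDerivAt_inner_mul_norm_sub_smul_rpow {p : E} (hp : p ≠ 0) (e : E) (b : ℝ) :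
    HasDerivAt (fun t : ℝ => inner ℝ (p - t • e) e * ‖p - t • e‖ ^ (-b))
      (b * (inner ℝ p e ^ 2 * ‖p‖ ^ (-(b + 2))) - ‖e‖ ^ 2 * ‖p‖ ^ (-b)) 0 := by
  have h1 : HasDerivAt (fun t : ℝ => inner ℝ (p - t • e) e) (-‖e‖ ^ 2) 0 := by
    have e1 : (fun t : ℝ => inner ℝ (p - t • e) e) = fun t : ℝ => inner ℝ p e - t * ‖e‖ ^ 2 := by
      funext t
      rw [inner_sub_left, inner_smul_left, real_inner_self_eq_norm_sq]; rfl
    rw [e1]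
    simpa using ((hasDerivAt_id (0 : ℝ)).mul_const (‖e‖ ^ 2)).const_sub (inner ℝ p e : ℝ)
  refine (h1.mul (hasDerivAt_norm_sub_smul_rpow hp e b)).congr_deriv ?_
  rw [zero_smul, sub_zero]
  ring

/-- Applying the Laplacian in `y` to `∫ w x * ‖x - y‖ ^ (-b) dx = 0` raises the exponent by two. -/
lemma integral_mul_rpow_norm_sub_add_two_eq_zero {w : E → ℝ} (hw : Continuous w) {M : ℝ}
    (hM : ∀ x, |w x| ≤ M) {r : ℝ} (hr : 0 < r) (hw0 : ∀ x, ‖x‖ < r → w x = 0)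
    {b : ℝ} (hb : (Module.finrank ℝ E : ℝ) < b)
    (h : ∀ y : E, ‖y‖ < r / 2 → ∫ x, w x * ‖x - y‖ ^ (-b) = 0) :
    ∀ y : E, ‖y‖ < r / 2 → ∫ x, w x * ‖x - y‖ ^ (-(b + 2)) = 0 := by
  have hb0 : 0 < b := (Nat.cast_nonneg _).trans_lt hb
  have hpow : ∀ p : E, p ≠ 0 → ∀ c : ℝ, ‖p‖ * ‖p‖ ^ (-(c + 1)) = ‖p‖ ^ (-c) := by
    intro p hp c
    rw [mul_comm, ← Real.rpow_add_one (norm_ne_zero_iff.2 hp)]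
    congr 1; ring
  have hinner : ∀ (e p : E), p ≠ 0 → ∀ c : ℝ,
      |inner ℝ p e * ‖p‖ ^ (-(c + 1))| ≤ ‖e‖ * ‖p‖ ^ (-c) := by
    intro e p hp c
    rw [abs_mul, abs_of_nonneg (Real.rpow_nonneg (norm_nonneg p) _)]
    calc |inner ℝ p e| * ‖p‖ ^ (-(c + 1)) ≤ ‖p‖ * ‖e‖ * ‖p‖ ^ (-(c + 1)) :=
          mul_le_mul_of_nonneg_right (abs_real_inner_le_norm p e)
            (Real.rpow_nonneg (norm_nonneg p) _)
      _ = ‖e‖ * ‖p‖ ^ (-c) := by rw [← hpow p hp c]; ring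
  have hsecond : ∀ (e p : E), p ≠ 0 →
      |(b + 2) * (inner ℝ p e ^ 2 * ‖p‖ ^ (-(b + 2 + 2))) - ‖e‖ ^ 2 * ‖p‖ ^ (-(b + 2))| ≤
        ((b + 2) * ‖e‖ ^ 2 + ‖e‖ ^ 2) * ‖p‖ ^ (-(b + 2)) := by
    intro e p hp
    have h0 := Real.rpow_nonneg (norm_nonneg p) (-(b + 2))
    have h1 : inner ℝ p e ^ 2 * ‖p‖ ^ (-(b + 2 + 2)) ≤ ‖e‖ ^ 2 * ‖p‖ ^ (-(b + 2)) := by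
      have e1 := hpow p hp (b + 2)
      have e2 := hpow p hp (b + 2 + 1)
      rw [show b + 2 + 1 + 1 = b + 2 + 2 by ring] at e2
      rw [← e1, ← e2]
      have h3 := Real.rpow_nonneg (norm_nonneg p) (-(b + 2 + 2))
      have h4 : inner ℝ p e ^ 2 ≤ (‖p‖ * ‖e‖) ^ 2 := by
        rw [← sq_abs]
        exact pow_le_pow_left₀ (abs_nonneg _) (abs_real_inner_le_norm p e) 2
      nlinarith
    have h2 : 0 ≤ inner ℝ p e ^ 2 * ‖p‖ ^ (-(b + 2 + 2)) :=
      mul_nonneg (sq_nonneg _) (Real.rpow_nonneg (norm_nonneg p) _)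
    have h5 : 0 ≤ ‖e‖ ^ 2 * ‖p‖ ^ (-(b + 2)) := by positivity
    rw [abs_le]
    constructor <;> nlinarith
  have hmeas : ∀ e : E, Measurable fun p : E =>
      (b + 2) * (inner ℝ p e ^ 2 * ‖p‖ ^ (-(b + 2 + 2))) - ‖e‖ ^ 2 * ‖p‖ ^ (-(b + 2)) := by
    intro e; fun_prop
  have hstep : ∀ e : E, ∀ y : E, ‖y‖ < r / 2 → ∫ x, w x * ((b + 2) *
      (inner ℝ (x - y) e ^ 2 * ‖x - y‖ ^ (-(b + 2 + 2))) - ‖e‖ ^ 2 * ‖x - y‖ ^ (-(b + 2))) = 0 := by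
    intro e
    have h1 := integral_mul_deriv_kernel_eq_zero hw hM hr hw0 (k := fun p => ‖p‖ ^ (-b))
      (k' := fun p => b * (inner ℝ p e * ‖p‖ ^ (-(b + 2)))) (by fun_prop) (by fun_prop) e
      (fun p hp => hasDerivAt_norm_sub_smul_rpow hp e b) (b := b) (b' := b + 1) (C := 1)
      (C' := b * ‖e‖) hb (by linarith) (fun p _ => ?_) (fun p hp => ?_) h
    · refine integral_mul_deriv_kernel_eq_zero hw hM hr hw0
        (k := fun p => inner ℝ p e * ‖p‖ ^ (-(b + 2))) (by fun_prop) (hmeas e) e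
        (fun p hp => hasDerivAt_inner_mul_norm_sub_smul_rpow hp e (b + 2)) (b := b + 1)
        (b' := b + 2) (C := ‖e‖) (by linarith) (by linarith)
        (fun p hp => ?_) (hsecond e) fun y hy => ?_
      · simpa [show b + 1 + 1 = b + 2 by ring] using hinner e p hp (b + 1)
      · have := h1 y hy
        simp_rw [mul_left_comm _ b] at this
        rw [integral_const_mul] at this
        exact (mul_eq_zero.1 this).resolve_left hb0.ne'
    · rw [one_mul, abs_of_nonneg (Real.rpow_nonneg (norm_nonneg _) _)]
    · rw [abs_mul, abs_of_pos hb0, mul_assoc]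
      refine mul_le_mul_of_nonneg_left ?_ hb0.le
      simpa [show b + 1 + 1 = b + 2 by ring] using hinner e p hp (b + 1)
  intro y hy
  -- Summing the second derivatives over an orthonormal basis gives the Laplacian. The trace leaves
  -- the factor `b + 2 - dim E`, positive since `b > dim E`.
  set B := stdOrthonormalBasis ℝ E
  have hsum : ∑ i, ∫ x, w x * ((b + 2) * (inner ℝ (x - y) (B i) ^ 2 * ‖x - y‖ ^ (-(b + 2 + 2))) -
      ‖B i‖ ^ 2 * ‖x - y‖ ^ (-(b + 2))) = 0 := Finset.sum_eq_zero fun i _ => hstep (B i) y hy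
  rw [← integral_finsetSum _ fun i _ => integrable_mul_kernel hw hM hr hw0 (hmeas (B i))
    (b := b + 2) (by linarith) (hsecond (B i)) hy.le] at hsum
  have hpt : ∀ x, ∑ i, w x * ((b + 2) * (inner ℝ (x - y) (B i) ^ 2 * ‖x - y‖ ^ (-(b + 2 + 2))) -
      ‖B i‖ ^ 2 * ‖x - y‖ ^ (-(b + 2))) =
      (b + 2 - Module.finrank ℝ E) * (w x * ‖x - y‖ ^ (-(b + 2))) := by
    intro x
    have e1 : ∑ i, inner ℝ (x - y) (B i) ^ 2 = ‖x - y‖ ^ 2 := by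
      simpa using B.sum_sq_norm_inner_left (x - y)
    rw [← Finset.mul_sum, Finset.sum_sub_distrib, ← Finset.mul_sum, ← Finset.sum_mul, e1]
    have e2 : ‖x - y‖ ^ 2 * ‖x - y‖ ^ (-(b + 2 + 2)) = ‖x - y‖ ^ (-(b + 2)) := by
      rcases eq_or_ne (x - y) 0 with h0 | h0
      -- At `x = y` the identity holds because `0 ^ c = 0` for every real `c ≠ 0`, negative `c`
      -- included.
      · rw [h0, norm_zero, Real.zero_rpow (by linarith), Real.zero_rpow (by linarith), mul_zero]
      · rw [mul_comm, ← Real.rpow_add_natCast (norm_ne_zero_iff.2 h0)]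
        congr 1; push_cast; ring
    rw [e2]
    simp only [B.norm_eq_one, one_pow, one_mul, Finset.sum_const, Finset.card_univ,
      Fintype.card_fin, nsmul_eq_mul]
    ring
  simp_rw [hpt] at hsum
  rw [integral_const_mul] at hsum
  exact (mul_eq_zero.1 hsum).resolve_left (by linarith)

lemma continuousOn_rpow_mul_exp_neg_inv {a : ℝ} (ha : 0 < a) :
    ContinuousOn (fun t : ℝ => t ^ (-a) * Real.exp (-t⁻¹)) (Set.Ici 0) := by
  intro t ht
  rcases eq_or_lt_of_le (Set.mem_Ici.1 ht) with rfl | h0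
  -- The default value `0 ^ (-a) = 0` agrees with the limit at `0`, because the exponential beats
  -- the power.
  · rw [← continuousWithinAt_Ioi_iff_Ici, ContinuousWithinAt, Real.zero_rpow (by linarith), zero_mul]
    refine ((tendsto_rpow_mul_exp_neg_mul_atTop_nhds_zero a 1 one_pos).comp
      tendsto_inv_nhdsGT_zero).congr' ?_
    filter_upwards [self_mem_nhdsWithin] with τ hτ
    rw [Function.comp_apply, neg_one_mul, Real.inv_rpow (le_of_lt hτ), Real.rpow_neg (le_of_lt hτ)]
  · refine ContinuousAt.continuousWithinAt ?_
    have h1 : ContinuousAt (fun t : ℝ => t ^ (-a)) t :=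
      Real.continuousAt_rpow_const _ _ (Or.inl h0.ne')
    exact h1.mul (Real.continuous_exp.continuousAt.comp (continuousAt_inv₀ h0.ne').neg)

/-- If all moments `∫ w x * ‖x - y‖ ^ (-(b + 2 k)) dx` vanish, then so does the Gaussian average of
`w` around `y`. -/
lemma integral_mul_gaussian_eq_zero_of_moments {w : E → ℝ} (hw : Continuous w) {M : ℝ}
    (hM : ∀ x, |w x| ≤ M) {r : ℝ} (hr : 0 < r) (hw0 : ∀ x, ‖x‖ < r → w x = 0)
    {b : ℝ} (hb : (Module.finrank ℝ E : ℝ) < b) {y : E} (hy : ‖y‖ ≤ r / 2)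
    (h : ∀ k : ℕ, ∫ x, w x * ‖x - y‖ ^ (-(b + 2 * k)) = 0) :
    ∫ x, w x * Real.exp (-‖x - y‖ ^ 2) = 0 := by
  have hb0 : 0 < b := (Nat.cast_nonneg _).trans_lt hb
  have hint : ∀ k : ℕ, Integrable fun x => w x * ‖x - y‖ ^ (-(b + 2 * k)) := fun k =>
    integrable_mul_kernel hw hM hr hw0 (k := fun p => ‖p‖ ^ (-(b + 2 * k))) (by fun_prop)
      (b := b + 2 * k) (C := 1) (hb.trans_le (by simp))
      (fun p _ => by rw [one_mul, abs_of_nonneg (Real.rpow_nonneg (norm_nonneg _) _)]) hy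
  have hint0 : Integrable fun x => w x * ‖x - y‖ ^ (-b) := by simpa using hint 0
  have hexp : Integrable fun x => w x * Real.exp (-‖x - y‖ ^ 2) := by
    refine (((integrable_exp_neg_norm_sq_add_mul_norm (E := E) 0).comp_sub_right y).const_mul
      M).mono' (by fun_prop) (.of_forall fun x => ?_)
    rw [norm_mul, Real.norm_eq_abs, Real.norm_eq_abs, Real.abs_exp, zero_mul, add_zero]
    exact mul_le_mul_of_nonneg_right (hM x) (Real.exp_pos _).le
  have hterm : ∀ (x : E) (k : ℕ), ‖x - y‖ ^ (-b) * ((‖x - y‖ ^ 2)⁻¹) ^ k =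
      ‖x - y‖ ^ (-(b + 2 * k)) := by
    intro x k
    rcases eq_or_ne (x - y) 0 with h0 | h0
    · rw [h0, norm_zero, Real.zero_rpow (by linarith), zero_mul, Real.zero_rpow (by
        have : (0 : ℝ) ≤ k := k.cast_nonneg
        linarith)]
    · rw [← Real.rpow_natCast, ← Real.rpow_neg_one, ← Real.rpow_natCast,
        ← Real.rpow_mul (norm_nonneg _), ← Real.rpow_mul (norm_nonneg _),
        ← Real.rpow_add (norm_pos_iff.2 h0)]
      congr 1; push_cast; ring
  have hsumeq : ∀ (P : Polynomial ℝ) (x : E),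
      w x * (‖x - y‖ ^ (-b) * P.eval (‖x - y‖ ^ 2)⁻¹) =
        ∑ k ∈ Finset.range (P.natDegree + 1), P.coeff k * (w x * ‖x - y‖ ^ (-(b + 2 * k))) := by
    intro P x
    rw [Polynomial.eval_eq_sum_range, Finset.mul_sum, Finset.mul_sum]
    refine Finset.sum_congr rfl fun k _ => ?_
    rw [← hterm]; ring
  have hpoly : ∀ P : Polynomial ℝ, Integrable (fun x =>
      w x * (‖x - y‖ ^ (-b) * P.eval (‖x - y‖ ^ 2)⁻¹)) ∧
      ∫ x, w x * (‖x - y‖ ^ (-b) * P.eval (‖x - y‖ ^ 2)⁻¹) = 0 := by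
    intro P
    simp_rw [hsumeq]
    refine ⟨integrable_finsetSum _ fun k _ => (hint k).const_mul _, ?_⟩
    rw [integral_finsetSum _ fun k _ => (hint k).const_mul _]
    exact Finset.sum_eq_zero fun k _ => by rw [integral_const_mul, h k, mul_zero]
  have hkey : ∀ ε > 0, |∫ x, w x * Real.exp (-‖x - y‖ ^ 2)| ≤
      ε * ∫ x, |w x * ‖x - y‖ ^ (-b)| := by
    intro ε hε
    -- With `ρ = ‖x - y‖ ≥ r / 2` and `t = ρ ^ (-2)`, `exp (-ρ²) = ρ ^ (-b) * (t ^ (-b/2) * exp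
    -- (-1/t))`. Keeping `ρ ^ (-b)` outside the approximation makes a uniform error `ε` integrable
    -- against `w`.
    obtain ⟨P, hP⟩ := exists_polynomial_near_of_continuousOn 0 ((r / 2) ^ 2)⁻¹ _
      ((continuousOn_rpow_mul_exp_neg_inv (half_pos hb0)).mono Set.Icc_subset_Ici_self) ε hε
    rw [← sub_zero (∫ x, w x * Real.exp (-‖x - y‖ ^ 2)), ← (hpoly P).2,
      ← integral_sub hexp (hpoly P).1, ← integral_const_mul, ← Real.norm_eq_abs]
    refine norm_integral_le_of_norm_le (hint0.abs.const_mul ε) (.of_forall fun x => ?_)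
    rcases lt_or_ge ‖x‖ r with hx | hx
    · simp [hw0 x hx]
    · have hxy : r / 2 ≤ ‖x - y‖ := by linarith [norm_sub_norm_le x y]
      have hpos : 0 < ‖x - y‖ := lt_of_lt_of_le (half_pos hr) hxy
      have hT : (‖x - y‖ ^ 2)⁻¹ ∈ Set.Icc 0 ((r / 2) ^ 2)⁻¹ :=
        ⟨by positivity, inv_anti₀ (by positivity) (by gcongr)⟩
      have h1 := hP _ hT
      have h2 : Real.exp (-‖x - y‖ ^ 2) = ‖x - y‖ ^ (-b) *
          (((‖x - y‖ ^ 2)⁻¹) ^ (-(b / 2)) * Real.exp (-((‖x - y‖ ^ 2)⁻¹)⁻¹)) := by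
        rw [inv_inv, ← mul_assoc, Real.inv_rpow (by positivity), Real.rpow_neg (by positivity) (b / 2),
          inv_inv, ← Real.rpow_natCast, ← Real.rpow_mul hpos.le, ← Real.rpow_add hpos]
        rw [show -b + ((2 : ℕ) : ℝ) * (b / 2) = 0 by push_cast; ring, Real.rpow_zero, one_mul]
      rw [h2, ← mul_sub, ← mul_sub, ← mul_assoc, norm_mul, Real.norm_eq_abs, Real.norm_eq_abs,
        mul_comm ε, abs_sub_comm]
      exact mul_le_mul_of_nonneg_left h1.le (abs_nonneg _)
  have hI : 0 ≤ ∫ x, |w x * ‖x - y‖ ^ (-b)| := integral_nonneg fun x => abs_nonneg _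
  rw [← abs_nonpos_iff]
  refine le_of_forall_pos_le_add fun δ hδ => ?_
  refine (hkey (δ / (1 + ∫ x, |w x * ‖x - y‖ ^ (-b)|)) (by positivity)).trans ?_
  rw [zero_add, div_mul_eq_mul_div, div_le_iff₀ (by positivity)]
  nlinarith

/-- Let `b > dim E`. A bounded continuous function `w` that vanishes near the origin and whose Riesz
type potential `∫ w x * ‖x - y‖ ^ (-b) dx` vanishes near the origin is zero. -/
theorem eq_zero_of_integral_mul_rpow_norm_sub_eq_zero {w : E → ℝ} (hw : Continuous w) {M : ℝ}
    (hM : ∀ x, |w x| ≤ M) {r : ℝ} (hr : 0 < r) (hw0 : ∀ x, ‖x‖ < r → w x = 0)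
    {b : ℝ} (hb : (Module.finrank ℝ E : ℝ) < b)
    (h : ∀ y : E, ‖y‖ < r / 2 → ∫ x, w x * ‖x - y‖ ^ (-b) = 0) (x : E) : w x = 0 := by
  have hmom : ∀ k : ℕ, ∀ y : E, ‖y‖ < r / 2 → ∫ x, w x * ‖x - y‖ ^ (-(b + 2 * k)) = 0 := by
    intro k
    induction k with
    | zero => simpa using h
    | succ k ih =>
      have := integral_mul_rpow_norm_sub_add_two_eq_zero hw hM hr hw0 (b := b + 2 * k)
        (hb.trans_le (by simp)) ih
      convert this using 8
      push_cast; ring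
  exact eq_zero_of_integral_mul_gaussian_eq_zero hw hM (half_pos hr) (fun y hy =>
    integral_mul_gaussian_eq_zero_of_moments hw hM hr hw0 hb hy.le fun k => hmom k y hy) x

end RieszKernel

section WeakForm

/-! ### The same uniqueness for potentials tested against smooth functions. -/

section RieszPotential

variable {E : Type*} [NormedAddCommGroup E]

lemma rpow_neg_norm_sub_le_of_center {r : ℝ} (hr : 0 < r) {x₀ x y : E} (hx : r ≤ ‖x - x₀‖)
    (hy : ‖y - x₀‖ ≤ r / 2) {b : ℝ} (hb : 0 ≤ b) :
    ‖x - y‖ ^ (-b) ≤ (r / (2 * (1 + r))) ^ (-b) * (1 + ‖x - x₀‖) ^ (-b) := by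
  simpa using rpow_neg_norm_sub_le hr hx hy hb

variable [InnerProductSpace ℝ E] [FiniteDimensional ℝ E] [MeasurableSpace E] [BorelSpace E]

omit [InnerProductSpace ℝ E] [FiniteDimensional ℝ E] [MeasurableSpace E] [BorelSpace E] in
lemma norm_mul_rpow_norm_sub_le {w : E → ℝ} {M : ℝ} (hM : ∀ x, |w x| ≤ M) {x₀ : E} {r : ℝ}
    (hr : 0 < r) (hw0 : ∀ x, ‖x - x₀‖ < r → w x = 0) {b : ℝ} (hb : 0 ≤ b) {y : E}
    (hy : ‖y - x₀‖ ≤ r / 2) (x : E) :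
    ‖w x * ‖x - y‖ ^ (-b)‖ ≤
      M * ((r / (2 * (1 + r))) ^ (-b) * (1 + ‖x - x₀‖) ^ (-b)) := by
  have hM0 : 0 ≤ M := (abs_nonneg _).trans (hM 0)
  rcases lt_or_ge ‖x - x₀‖ r with hx | hx
  · rw [hw0 x hx, zero_mul, norm_zero]; positivity
  · rw [norm_mul, Real.norm_eq_abs, Real.norm_eq_abs, abs_of_nonneg (Real.rpow_nonneg (norm_nonneg _) _)]
    exact mul_le_mul (hM x) (rpow_neg_norm_sub_le_of_center hr hx hy hb)
      (Real.rpow_nonneg (norm_nonneg _) _) hM0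

lemma integrable_one_add_norm_sub (x₀ : E) {b : ℝ} (hb : (Module.finrank ℝ E : ℝ) < b) (C D : ℝ) :
    Integrable fun x : E => C * (D * (1 + ‖x - x₀‖) ^ (-b)) :=
  (((integrable_one_add_norm (μ := volume) hb).comp_sub_right x₀).const_mul D).const_mul C

/-- Testing yields vanishing almost everywhere; continuity upgrades it to every point of the ball.
-/
lemma continuousOn_integral_mul_rpow_norm_sub {w : E → ℝ} (hw : Continuous w) {M : ℝ}
    (hM : ∀ x, |w x| ≤ M) {x₀ : E} {r : ℝ} (hr : 0 < r) (hw0 : ∀ x, ‖x - x₀‖ < r → w x = 0)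
    {b : ℝ} (hb : (Module.finrank ℝ E : ℝ) < b) :
    ContinuousOn (fun y => ∫ x, w x * ‖x - y‖ ^ (-b)) (Metric.ball x₀ (r / 2)) := by
  have hb0 : 0 ≤ b := (Nat.cast_nonneg _).trans hb.le
  refine continuousOn_of_dominated (fun y _ => ?_) (fun y hy => .of_forall fun x =>
    norm_mul_rpow_norm_sub_le hM hr hw0 hb0 (mem_ball_iff_norm.1 hy).le x)
    (integrable_one_add_norm_sub x₀ hb _ _) (.of_forall fun x => ?_)
  · exact (hw.measurable.mul (by fun_prop)).aestronglyMeasurable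
  · rcases lt_or_ge ‖x - x₀‖ r with hx | hx
    · simpa [hw0 x hx] using continuousOn_const
    · refine continuousOn_const.mul (ContinuousOn.rpow_const (by fun_prop) fun y hy => Or.inl ?_)
      rw [mem_ball_iff_norm] at hy
      intro h0
      rw [norm_eq_zero, sub_eq_zero] at h0
      rw [h0] at hx
      linarith

/-- Distributional version of `eq_zero_of_integral_mul_rpow_norm_sub_eq_zero`, around any point. -/
theorem eq_zero_of_weak_integral_mul_rpow_norm_sub_eq_zero {w : E → ℝ} (hw : Continuous w) {M : ℝ}
    (hM : ∀ x, |w x| ≤ M) {x₀ : E} {r : ℝ} (hr : 0 < r) (hw0 : ∀ x, ‖x - x₀‖ < r → w x = 0)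
    {b : ℝ} (hb : (Module.finrank ℝ E : ℝ) < b)
    (h : ∀ φ : E → ℝ, ContDiff ℝ ∞ φ → HasCompactSupport φ → tsupport φ ⊆ Metric.ball x₀ (r / 2) →
      ∫ x, w x * ∫ z, φ z * ‖x - z‖ ^ (-b) = 0) (x : E) : w x = 0 := by
  have hb0 : 0 ≤ b := (Nat.cast_nonneg _).trans hb.le
  have hcont := continuousOn_integral_mul_rpow_norm_sub hw hM hr hw0 hb
  have hae : ∀ᵐ y : E, y ∈ Metric.ball x₀ (r / 2) → ∫ x, w x * ‖x - y‖ ^ (-b) = 0 := by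
    refine Metric.isOpen_ball.ae_eq_zero_of_integral_contDiff_smul_eq_zero
      (hcont.locallyIntegrableOn Metric.isOpen_ball.measurableSet) fun φ hφ hφc hφs => ?_
    have hφi : Integrable φ := hφ.continuous.integrable_of_hasCompactSupport hφc
    rw [← h φ hφ hφc hφs]
    simp_rw [smul_eq_mul, ← integral_const_mul]
    -- The singularity `x = z` is harmless: `φ` lives in the ball of radius `r / 2`, while `w`
    -- vanishes on the one of radius `r`.
    have hI : Integrable (Function.uncurry fun z x => φ z * (w x * ‖x - z‖ ^ (-b)))
        ((volume : Measure E).prod volume) := by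
      refine (hφi.norm.mul_prod
        (integrable_one_add_norm_sub x₀ hb M ((r / (2 * (1 + r))) ^ (-b)))).mono' ?_
        (.of_forall fun p => ?_)
      · have h1 := hφ.continuous
        refine Measurable.aestronglyMeasurable ?_
        exact (h1.measurable.comp measurable_fst).mul
          ((hw.measurable.comp measurable_snd).mul (by fun_prop))
      · obtain ⟨z, x⟩ := p
        simp only [Function.uncurry_apply_pair]
        rw [norm_mul]
        by_cases hz : φ z = 0
        · simp [hz]
        · have hz' := hφs (subset_tsupport φ hz)
          exact mul_le_mul_of_nonneg_left
            (norm_mul_rpow_norm_sub_le hM hr hw0 hb0 (mem_ball_iff_norm.1 hz').le x) (norm_nonneg _)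
    rw [integral_integral_swap hI]
    simp_rw [mul_left_comm]
  have hzero : ∀ y ∈ Metric.ball x₀ (r / 2), ∫ x, w x * ‖x - y‖ ^ (-b) = 0 :=
    Measure.eqOn_open_of_ae_eq (μ := volume)
      ((ae_restrict_iff' Metric.isOpen_ball.measurableSet).2 hae) Metric.isOpen_ball hcont
      continuousOn_const
  have := eq_zero_of_integral_mul_rpow_norm_sub_eq_zero (w := fun x => w (x + x₀)) (by fun_prop)
    (fun x => hM _) hr (fun x hx => hw0 _ (by simpa using hx)) hb (fun y hy => ?_) (x - x₀)
  · simpa using this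
  · rw [← hzero (y + x₀) (by simpa using hy),
      ← integral_add_right_eq_self (fun x => w x * ‖x - (y + x₀)‖ ^ (-b)) x₀]
    simp

end RieszPotential

/-! ### Symmetry and decay of the Lévy operator, and the weak equation on the closure. -/

variable {𝕜 : Type*} [RCLike 𝕜] {n : ℕ} {s : ℝ}

lemma fracLaplacianConst_pos (hs0 : 0 < s) (hs1 : s < 1) : 0 < fracLaplacianConst n s := by
  have h1 : 0 < Real.Gamma (s + (n : ℝ) / 2) := Real.Gamma_pos_of_pos (by positivity)
  have h2 : 0 < Real.Gamma (1 - s) := Real.Gamma_pos_of_pos (by linarith)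
  unfold fracLaplacianConst
  have := Real.pi_pos
  positivity

/-- The second order Taylor bound for the increments in `fracLevy`. -/
lemma exists_norm_levyIncrement_le {u : EuclideanSpace ℝ (Fin n) → 𝕜} (hu : ContDiff ℝ ∞ u)
    (hc : HasCompactSupport u) : ∃ K M : ℝ, ∀ x y,
      ‖u (x + y) - u x - if ‖y‖ < 1 then fderiv ℝ u x y else 0‖ ≤
        if ‖y‖ < 1 then K * ‖y‖ ^ 2 else M := by
  have hd : Differentiable ℝ u := hu.differentiable (by simp)
  have hu' : ContDiff ℝ 1 (fderiv ℝ u) := hu.fderiv_right (by norm_cast)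
  obtain ⟨K, hK⟩ := hu'.lipschitzWith_of_hasCompactSupport (hc.fderiv (𝕜 := ℝ)) (by simp)
  obtain ⟨M, hM⟩ := hu.continuous.bounded_above_of_compact_support hc
  refine ⟨K, 2 * M, fun x y => ?_⟩
  split_ifs with h
  · have := (convex_closedBall x ‖y‖).norm_image_sub_le_of_norm_fderiv_le' (𝕜 := ℝ) (f := u)
      (φ := fderiv ℝ u x) (C := K * ‖y‖) (x := x) (y := x + y) (fun z _ => hd z)
      (fun z hz => ?_) (by simp) (by simp)
    · simpa [pow_two, mul_assoc] using this
    · refine (hK.norm_sub_le z x).trans ?_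
      gcongr
      simpa [dist_eq_norm] using hz
  · rw [sub_zero]
    refine (norm_sub_le _ _).trans ?_
    linarith [hM (x + y), hM x]

lemma measurable_levyIncrement {u : EuclideanSpace ℝ (Fin n) → 𝕜} (hu : ContDiff ℝ ∞ u) :
    Measurable fun p : EuclideanSpace ℝ (Fin n) × EuclideanSpace ℝ (Fin n) =>
      u (p.1 + p.2) - u p.1 - if ‖p.2‖ < 1 then fderiv ℝ u p.1 p.2 else 0 := by
  have h1 := hu.continuous
  have h2 : Continuous (fderiv ℝ u) := hu.continuous_fderiv (by simp)
  refine Measurable.sub (by fun_prop) (Measurable.ite ?_ ?_ measurable_const)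
  · exact measurableSet_lt (by fun_prop) measurable_const
  · exact (Continuous.clm_apply (h2.comp continuous_fst) continuous_snd).measurable

/-- For fixed increment `y`, the formal adjoint of the increment operator is the one for `-y`. -/
lemma integral_smul_levyIncrement {φ : EuclideanSpace ℝ (Fin n) → ℝ}
    {w : EuclideanSpace ℝ (Fin n) → 𝕜} (hφ : ContDiff ℝ ∞ φ) (hφc : HasCompactSupport φ)
    (hw : ContDiff ℝ ∞ w) (hwc : HasCompactSupport w) (y : EuclideanSpace ℝ (Fin n)) :
    ∫ x, φ x • (w (x + y) - w x - if ‖y‖ < 1 then fderiv ℝ w x y else 0) =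
      ∫ x, (φ (x + -y) - φ x - if ‖-y‖ < 1 then fderiv ℝ φ x (-y) else 0) • w x := by
  have h1 := hφ.continuous
  have h2 := hw.continuous
  have h3 : Continuous (fderiv ℝ w) := hw.continuous_fderiv (by simp)
  have h4 : Continuous (fderiv ℝ φ) := hφ.continuous_fderiv (by simp)
  have i1 : Integrable fun x => φ x • w (x + y) :=
    Continuous.integrable_of_hasCompactSupport (by fun_prop) hφc.smul_right
  have i2 : Integrable fun x => φ x • w x :=
    Continuous.integrable_of_hasCompactSupport (by fun_prop) hφc.smul_right
  have i3 : Integrable fun x => φ x • fderiv ℝ w x y :=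
    Continuous.integrable_of_hasCompactSupport (by fun_prop) hφc.smul_right
  have i4 : Integrable fun x => φ (x + -y) • w x :=
    Continuous.integrable_of_hasCompactSupport (by fun_prop)
      (HasCompactSupport.smul_left (f := fun x => φ (x + -y)) hwc)
  have i5 : Integrable fun x => fderiv ℝ φ x y • w x :=
    Continuous.integrable_of_hasCompactSupport (by fun_prop)
      (HasCompactSupport.smul_left (f := fun x => fderiv ℝ φ x y) hwc)
  -- Translation moves the difference onto `φ`, and integration by parts moves the gradient; both
  -- replace `y` by `-y`.
  have e1 : ∫ x, φ (x + -y) • w x = ∫ x, φ x • w (x + y) := by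
    rw [← integral_add_right_eq_self _ y]
    simp
  have e2 : ∫ x, φ x • fderiv ℝ w x y = -∫ x, fderiv ℝ φ x y • w x :=
    integral_smul_fderiv_eq_neg_fderiv_smul_of_integrable i5 i3 i2
      (fun x _ => hφ.differentiable (by simp) x) (fun x _ => hw.differentiable (by simp) x)
  have i12 : Integrable fun x => φ x • w (x + y) - φ x • w x := i1.sub i2
  have i42 : Integrable fun x => φ (x + -y) • w x - φ x • w x := i4.sub i2
  by_cases hy : ‖y‖ < 1
  · have l : ∀ x, φ x • (w (x + y) - w x - fderiv ℝ w x y) =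
        φ x • w (x + y) - φ x • w x - φ x • fderiv ℝ w x y := fun x => by
      rw [smul_sub, smul_sub]
    have l' : ∀ x, (φ (x + -y) - φ x - fderiv ℝ φ x (-y)) • w x =
        φ (x + -y) • w x - φ x • w x + fderiv ℝ φ x y • w x := fun x => by
      rw [map_neg, sub_neg_eq_add, add_smul, sub_smul]
    simp only [norm_neg, if_pos hy, l, l']
    rw [integral_sub i12 i3, integral_sub i1 i2, integral_add i42 i5,
      integral_sub i4 i2, e1, e2, sub_neg_eq_add]
  · simp only [norm_neg, if_neg hy, sub_zero, smul_sub, sub_smul]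
    rw [integral_sub i1 i2, integral_sub i4 i2, e1]

/-- `fracLevy` is symmetric on test functions. -/
theorem integral_smul_fracLevy (hn : 1 ≤ n) (hs0 : 0 < s) (hs1 : s < 1)
    {φ : EuclideanSpace ℝ (Fin n) → ℝ} {w : EuclideanSpace ℝ (Fin n) → 𝕜} (hφ : ContDiff ℝ ∞ φ)
    (hφc : HasCompactSupport φ) (hw : ContDiff ℝ ∞ w) (hwc : HasCompactSupport w) :
    ∫ x, φ x • fracLevy s w x = ∫ x, fracLevy s φ x • w x := by
  obtain ⟨K, M, hKM⟩ := exists_norm_levyIncrement_le hw hwc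
  obtain ⟨K', M', hKM'⟩ := exists_norm_levyIncrement_le hφ hφc
  have hφi : Integrable φ := hφ.continuous.integrable_of_hasCompactSupport hφc
  have hwi : Integrable w := hw.continuous.integrable_of_hasCompactSupport hwc
  have h1 := hφ.continuous
  have h2 := hw.continuous
  set k : EuclideanSpace ℝ (Fin n) → ℝ := fun y =>
    fracLaplacianConst n s * ‖y‖ ^ (-(n : ℝ) - 2 * s) with hk
  have hkm : Measurable k := by fun_prop
  set Dw : EuclideanSpace ℝ (Fin n) → EuclideanSpace ℝ (Fin n) → 𝕜 := fun x y =>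
    w (x + y) - w x - if ‖y‖ < 1 then fderiv ℝ w x y else 0 with hDw
  set Dφ : EuclideanSpace ℝ (Fin n) → EuclideanSpace ℝ (Fin n) → ℝ := fun x y =>
    φ (x + y) - φ x - if ‖y‖ < 1 then fderiv ℝ φ x y else 0 with hDφ
  -- Fubini applies to the compensated increment: its bound of order `‖y‖ ^ 2` near `0` beats the
  -- singular kernel since `s < 1`.
  have hI1 : Integrable (Function.uncurry fun x y => φ x • (k y • Dw x y)) (volume.prod volume) := by
    refine (hφi.norm.mul_prod
      (fracKernel_integrable hn hs0 hs1 (fracLaplacianConst n s) K M)).mono' ?_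
      (.of_forall fun p => ?_)
    · exact ((h1.measurable.comp measurable_fst).smul ((hkm.comp measurable_snd).smul
        (measurable_levyIncrement hw))).aestronglyMeasurable
    · simp only [Function.uncurry, norm_smul]
      exact mul_le_mul_of_nonneg_left (mul_le_mul_of_nonneg_left (hKM _ _) (abs_nonneg _))
        (norm_nonneg _)
  have hI2 : Integrable (Function.uncurry fun x y => (k y • Dφ x y) • w x)
      (volume.prod volume) := by
    refine (hwi.norm.mul_prod
      (fracKernel_integrable hn hs0 hs1 (fracLaplacianConst n s) K' M')).mono' ?_
      (.of_forall fun p => ?_)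
    · exact (((hkm.comp measurable_snd).smul (measurable_levyIncrement hφ)).smul
        (h2.measurable.comp measurable_fst)).aestronglyMeasurable
    · simp only [Function.uncurry]
      rw [norm_smul, norm_smul, mul_comm]
      exact mul_le_mul_of_nonneg_left (mul_le_mul_of_nonneg_left (hKM' _ _) (abs_nonneg _))
        (norm_nonneg _)
  calc ∫ x, φ x • fracLevy s w x = ∫ x, ∫ y, φ x • (k y • Dw x y) := by
        simp_rw [integral_smul]; rfl
    _ = ∫ y, ∫ x, φ x • (k y • Dw x y) := integral_integral_swap hI1
    _ = ∫ y, k y • ∫ x, φ x • Dw x y := by simp_rw [smul_comm (φ _), integral_smul]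
    -- The kernel is even, so the reflection `y ↦ -y` undoes the sign change of the adjoint.
    _ = ∫ y, k (-y) • ∫ x, Dφ x (-y) • w x := by
        refine integral_congr_ae (.of_forall fun y => ?_)
        simp only [hDw, hDφ, hk]
        rw [integral_smul_levyIncrement hφ hφc hw hwc y, norm_neg]
    _ = ∫ y, k y • ∫ x, Dφ x y • w x :=
        integral_neg_eq_self (fun y => k y • ∫ x, Dφ x y • w x) volume
    _ = ∫ y, ∫ x, (k y • Dφ x y) • w x := by simp_rw [smul_assoc, integral_smul]
    _ = ∫ x, ∫ y, (k y • Dφ x y) • w x := (integral_integral_swap hI2).symm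
    _ = ∫ x, fracLevy s φ x • w x := by
        simp_rw [integral_smul_const]; rfl

/-- Away from the support, `fracLevy` is given by the potential of its kernel. -/
lemma fracLevy_eq_of_notMem_tsupport {φ : EuclideanSpace ℝ (Fin n) → ℝ}
    {x : EuclideanSpace ℝ (Fin n)} (hx : x ∉ tsupport φ) :
    fracLevy s φ x = fracLaplacianConst n s * ∫ z, φ z * ‖x - z‖ ^ (-((n : ℝ) + 2 * s)) := by
  have h0 : φ x = 0 := image_eq_zero_of_notMem_tsupport hx
  have h1 : fderiv ℝ φ x = 0 := image_eq_zero_of_notMem_tsupport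
    fun h => hx (tsupport_fderiv_subset ℝ h)
  unfold fracLevy
  rw [← integral_const_mul, ← integral_add_right_eq_self
    (fun z => fracLaplacianConst n s * (φ z * ‖x - z‖ ^ (-((n : ℝ) + 2 * s)))) x]
  refine integral_congr_ae (.of_forall fun y => ?_)
  have e1 : x - (y + x) = -y := by abel
  have e2 : -(n : ℝ) - 2 * s = -((n : ℝ) + 2 * s) := by ring
  simp only [h0, h1, e1, e2, norm_neg, smul_eq_mul, zero_apply, ite_self, sub_zero, add_comm x y]
  ring

lemma continuous_fracLevy (hn : 1 ≤ n) (hs0 : 0 < s) (hs1 : s < 1)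
    {φ : EuclideanSpace ℝ (Fin n) → 𝕜} (hφ : ContDiff ℝ ∞ φ) (hφc : HasCompactSupport φ) :
    Continuous (fracLevy s φ) := by
  obtain ⟨f, -, -, hf⟩ := exists_mem_fracLaplacianTestGraph (𝕜 := 𝕜) hn hs0 hs1
    ⟨⟨φ, hφ.continuous⟩, hφc.is_zero_at_infty⟩ hφ hφc
  have : fracLevy s φ = fun x => -f x := by
    funext x
    rw [hf x, fracLaplacian, neg_neg]; rfl
  rw [this]
  exact f.continuous.neg

/-- On a compact ball continuity suffices; outside, the potential formula gives decay of order `n +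
2s > n`. Integrability is what allows pairing with arbitrary elements of `C₀`. -/
lemma integrable_fracLevy (hn : 1 ≤ n) (hs0 : 0 < s) (hs1 : s < 1)
    {φ : EuclideanSpace ℝ (Fin n) → ℝ} (hφ : ContDiff ℝ ∞ φ) (hφc : HasCompactSupport φ)
    {x₀ : EuclideanSpace ℝ (Fin n)} {r : ℝ} (hr : 0 < r)
    (hφs : tsupport φ ⊆ Metric.ball x₀ (r / 2)) : Integrable (fracLevy s φ) := by
  have hcont := continuous_fracLevy hn hs0 hs1 hφ hφc
  have hφi : Integrable φ := hφ.continuous.integrable_of_hasCompactSupport hφc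
  rw [← integrableOn_univ, ← Set.union_compl_self (Metric.closedBall x₀ r)]
  refine (hcont.continuousOn.integrableOn_compact (isCompact_closedBall x₀ r)).union ?_
  refine Integrable.mono' (integrable_one_add_norm_sub x₀ (b := n + 2 * s)
    (by rw [finrank_euclideanSpace_fin]; linarith) (fracLaplacianConst n s * ∫ z, ‖φ z‖)
    ((r / (2 * (1 + r))) ^ (-((n : ℝ) + 2 * s)))).integrableOn hcont.aestronglyMeasurable ?_
  refine (ae_restrict_iff' Metric.isClosed_closedBall.measurableSet.compl).2
    (.of_forall fun x hx => ?_)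
  have hx' : r < ‖x - x₀‖ := by simpa [dist_eq_norm] using hx
  have hxs : x ∉ tsupport φ := fun h => by
    have := mem_ball_iff_norm.1 (hφs h)
    linarith
  have hc := fracLaplacianConst_pos (n := n) hs0 hs1
  rw [fracLevy_eq_of_notMem_tsupport hxs, norm_mul, Real.norm_eq_abs, abs_of_pos hc, mul_assoc]
  refine mul_le_mul_of_nonneg_left ?_ hc.le
  rw [← integral_mul_const]
  refine norm_integral_le_of_norm_le (hφi.norm.mul_const _) (.of_forall fun z => ?_)
  rw [norm_mul]
  by_cases hz : φ z = 0
  · simp [hz]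
  · have hz' := mem_ball_iff_norm.1 (hφs (subset_tsupport φ hz))
    rw [Real.norm_eq_abs (_ ^ _), abs_of_nonneg (Real.rpow_nonneg (norm_nonneg _) _)]
    exact mul_le_mul_of_nonneg_left (rpow_neg_norm_sub_le_of_center hr hx'.le hz'.le
      (by positivity)) (norm_nonneg _)

/-- Makes both sides of the weak identity continuous in sup-norm, so that it passes from test
functions to the closure of the graph. -/
lemma continuous_integral_smul_zeroAtInfty {E : Type*} [TopologicalSpace E] [MeasurableSpace E]
    [OpensMeasurableSpace E] {μ : Measure E} {g : E → ℝ} (hg : Integrable g μ) :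
    Continuous fun u : C₀(E, 𝕜) => ∫ x, g x • u x ∂μ := by
  have hb : ∀ (u : C₀(E, 𝕜)) x, ‖u x‖ ≤ ‖u‖ := fun u x => u.toBCF.norm_coe_le_norm x
  have hi : ∀ u : C₀(E, 𝕜), Integrable (fun x => g x • u x) μ := fun u =>
    hg.smul_bdd ‖u‖ (map_continuous u).measurable.aestronglyMeasurable (.of_forall (hb u))
  refine (LipschitzWith.of_dist_le' (K := ∫ x, ‖g x‖ ∂μ) fun u v => ?_).continuous
  rw [dist_eq_norm, dist_eq_norm, ← integral_sub (hi u) (hi v), ← integral_mul_const]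
  refine norm_integral_le_of_norm_le (hg.norm.mul_const _) (.of_forall fun x => ?_)
  rw [← smul_sub, norm_smul]
  exact mul_le_mul_of_nonneg_left (hb (u - v) x) (norm_nonneg _)

/-- The weak formulation of `(-Δ)^s u = f` for the closed operator. -/
theorem integral_smul_eq_of_mem_fracLaplacianGraph (hn : 1 ≤ n) (hs0 : 0 < s) (hs1 : s < 1)
    {u f : C₀(EuclideanSpace ℝ (Fin n), 𝕜)} (h : (u, f) ∈ fracLaplacianGraph 𝕜 n s)
    {φ : EuclideanSpace ℝ (Fin n) → ℝ} (hφ : ContDiff ℝ ∞ φ) (hφc : HasCompactSupport φ)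
    (hφi : Integrable (fracLevy s φ)) :
    ∫ x, φ x • f x = -∫ x, fracLevy s φ x • u x := by
  have hc1 := continuous_integral_smul_zeroAtInfty (𝕜 := 𝕜)
    (hφ.continuous.integrable_of_hasCompactSupport hφc : Integrable φ)
  have hc2 := continuous_integral_smul_zeroAtInfty (𝕜 := 𝕜) hφi
  have hcl : IsClosed {p : C₀(EuclideanSpace ℝ (Fin n), 𝕜) × C₀(EuclideanSpace ℝ (Fin n), 𝕜) |
      ∫ x, φ x • p.2 x = -∫ x, fracLevy s φ x • p.1 x} :=
    isClosed_eq (hc1.comp continuous_snd) (hc2.comp continuous_fst).neg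
  refine closure_minimal (fun p hp => ?_) hcl h
  obtain ⟨hp1, hp2, hp3⟩ := hp
  simp only [Set.mem_ofPred_eq, hp3, fracLaplacian, smul_neg, integral_neg]
  rw [integral_smul_fracLevy hn hs0 hs1 hφ hφc hp1 hp2]

end WeakForm

/-! ### Unique continuation. -/

theorem corollary2p9 (𝕜 : Type*) [RCLike 𝕜] (n : ℕ) (hn : 1 ≤ n) (s : ℝ) (hs0 : 0 < s)
    (hs1 : s < 1) : SatisfiesUCP (fracLaplacianGraph 𝕜 n s) := by
  intro G hG ⟨x₀, hx₀⟩ u f huf hf hu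
  obtain ⟨r, hr, hball⟩ := Metric.isOpen_iff.1 hG x₀ hx₀
  have hb : (Module.finrank ℝ (EuclideanSpace ℝ (Fin n)) : ℝ) < n + 2 * s := by
    rw [finrank_euclideanSpace_fin]; linarith
  have hbd : ∀ x, ‖u x‖ ≤ ‖u‖ := fun x => u.toBCF.norm_coe_le_norm x
  have hu0 : ∀ x, ‖x - x₀‖ < r → u x = 0 := fun x hx => hu x (hball (mem_ball_iff_norm.2 hx))
  have hweak : ∀ φ : EuclideanSpace ℝ (Fin n) → ℝ, ContDiff ℝ ∞ φ → HasCompactSupport φ →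
      tsupport φ ⊆ Metric.ball x₀ (r / 2) →
      Integrable (fun x => (∫ z, φ z * ‖x - z‖ ^ (-((n : ℝ) + 2 * s))) • u x) ∧
        ∫ x, (∫ z, φ z * ‖x - z‖ ^ (-((n : ℝ) + 2 * s))) • u x = 0 := by
    intro φ hφ hφc hφs
    have hc := fracLaplacianConst_pos (n := n) hs0 hs1
    have hLi := integrable_fracLevy hn hs0 hs1 hφ hφc hr hφs
    have hmain := integral_smul_eq_of_mem_fracLaplacianGraph hn hs0 hs1 huf hφ hφc hLi
    have h0 : ∀ x, φ x • f x = 0 := by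
      intro x
      by_cases hx : φ x = 0
      · rw [hx, zero_smul]
      · rw [hf x (hball (Metric.ball_subset_ball (by linarith) (hφs (subset_tsupport φ hx)))),
          smul_zero]
    -- Within distance `r` of `x₀` both sides vanish with `u`; farther away `x` lies off the support
    -- of `φ` and the potential formula applies.
    have heq : ∀ x, (∫ z, φ z * ‖x - z‖ ^ (-((n : ℝ) + 2 * s))) • u x =
        (fracLaplacianConst n s)⁻¹ • (fracLevy s φ x • u x) := by
      intro x
      rcases lt_or_ge ‖x - x₀‖ r with hx | hx
      · rw [hu0 x hx, smul_zero, smul_zero, smul_zero]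
      · rw [fracLevy_eq_of_notMem_tsupport fun h => by
          have := mem_ball_iff_norm.1 (hφs h)
          linarith, smul_smul, inv_mul_cancel_left₀ hc.ne']
    simp_rw [h0, integral_zero, zero_eq_neg] at hmain
    simp_rw [heq]
    refine ⟨Integrable.smul (fracLaplacianConst n s)⁻¹ (hLi.smul_bdd ‖u‖ (map_continuous u).measurable.aestronglyMeasurable
      (.of_forall hbd)), ?_⟩
    rw [integral_smul, hmain, smul_zero]
  -- The uniqueness theorem is for real functions. The potential is real, so the weak identity
  -- splits into real and imaginary parts.
  have hre : ∀ x, RCLike.re (u x) = 0 := by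
    refine eq_zero_of_weak_integral_mul_rpow_norm_sub_eq_zero (M := ‖u‖) (x₀ := x₀)
      (RCLike.continuous_re.comp u.continuous)
      (fun x => (RCLike.abs_re_le_norm _).trans (hbd x)) hr (fun x hx => by simp [hu0 x hx]) hb
      fun φ hφ hφc hφs => ?_
    obtain ⟨hi, h0⟩ := hweak φ hφ hφc hφs
    have := RCLike.reCLM.integral_comp_comm hi
    rw [h0, map_zero] at this
    simpa [RCLike.smul_re, mul_comm] using this
  have him : ∀ x, RCLike.im (u x) = 0 := by
    refine eq_zero_of_weak_integral_mul_rpow_norm_sub_eq_zero (M := ‖u‖) (x₀ := x₀)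
      (RCLike.continuous_im.comp u.continuous)
      (fun x => (RCLike.abs_im_le_norm _).trans (hbd x)) hr (fun x hx => by simp [hu0 x hx]) hb
      fun φ hφ hφc hφs => ?_
    obtain ⟨hi, h0⟩ := hweak φ hφ hφc hφs
    have := RCLike.imCLM.integral_comp_comm hi
    rw [h0, map_zero] at this
    simpa [RCLike.smul_im, mul_comm] using this
  exact fun x => RCLike.ext (by simpa using hre x) (by simpa using him x)
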